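/- **Metric Closing Lemma.** Conventions: an isometry $\psi$ of a metric space $Z$ has translation length $|\psi|=\inf_{x\in Z}d(x,\psi x)$, and is of hyperbolic type if this infimum is attained and positive. In a geodesic CAT$(-1)$ space a hyperbolic isometry $\psi$ has an axis $A_\psi$, the unique geodesic line invariant under $\psi$, and $d(x,\psi x)=|\psi|$ for $x\in A_\psi$. For $\varepsilon>0$, $\mathcal N_\varepsilon(A)$ is the open $\varepsilon$-neighborhood of $A$. A geodesic space is $\delta$-hyperbolic if every side of every geodesic triangle lies in the closed $\delta$-neighborhood of the union of the two other sides. Geodesics have unit speed. For $\varepsilon_0>0$, $\delta_0\ge 0$, $c_0>0$, $l_0$, put $s_0=4\varepsilon_0+6\delta_0$ and say that the closing property holds in $Z$ (for $\delta_0,\varepsilon_0,c_0,l_0$) if for all $l\ge l_0$ and $s>s_0$, every geodesic segment $\gamma:[0,s+l]\to Z$ and every hyperbolic isometry $\psi$ of $Z$ with $|\psi|\ge 4\delta_0$ such that $$d(\gamma(s+t),\psi(\gamma(t)))\le\varepsilon_0\quad\text{for all }t\in[0,l],$$ the axis $A_\psi$ exists, $\psi$ moves each of its points by $|\psi|$,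 and $$s-2\varepsilon_0\le|\psi|\le s+\varepsilon_0,\qquad \gamma([c_0,s+l-c_0])\subset\mathcal N_{\varepsilon_0/8}(A_\psi).$$ Let $\varepsilon_0>0$. (1) Let $\delta_0=\log(1+\sqrt2)$. There are constants $c_0=c_0(\varepsilon_0)$ with $0<c_0\le 2\delta_0+\varepsilon_0-\log(\varepsilon_0/8)$ and $l_0=l_0(\varepsilon_0)\ge 4\delta_0+\varepsilon_0$ with $s_0+l_0\ge 2c_0$ such that the closing property holds in the real hyperbolic space $\mathbb H^{n+1}$ for every $n\ge 0$, and in every proper geodesic CAT$(-1)$ space. (2) For every $\delta_0\ge 0$ there are constants $c_0=c_0(\varepsilon_0,\delta_0)$ with $0<c_0\le 2\delta_0+\varepsilon_0-\log(\varepsilon_0/8)$ and $l_0=l_0(\varepsilon_0,\delta_0)\ge 4\delta_0+\varepsilon_0$ with $s_0+l_0\ge 2c_0$ such that the closing property holds in every proper geodesic CAT$(-1)$ space that is $\delta_0$-hyperbolic. -/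

import Mathlib

universe u

/-! ### Geodesics, geodesic triangles and comparison with the hyperbolic plane -/

/-- `γ`, restricted to `[a, b]`, is a unit speed geodesic segment: an isometric embedding of
`[a, b]`. Values of `γ` outside `[a, b]` are irrelevant. -/
def IsGeodesicOn {X : Type*} [MetricSpace X] (γ : ℝ → X) (a b : ℝ) : Prop :=
  ∀ s ∈ Set.Icc a b, ∀ t ∈ Set.Icc a b, dist (γ s) (γ t) = |s - t|

/-- `S` is (the image of) a geodesic segment from `x` to `y`. -/
def IsSegment {X : Type*} [MetricSpace X] (S : Set X) (x y : X) : Prop :=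
  ∃ γ : ℝ → X, IsGeodesicOn γ 0 (dist x y) ∧ γ 0 = x ∧ γ (dist x y) = y ∧
    S = γ '' Set.Icc 0 (dist x y)

/-- A geodesic `CAT(-1)` space. Two sides of a geodesic triangle issue from a common vertex and are
parametrized from there as `σ` and `τ`; `σ'`, `τ'` are the corresponding sides of a comparison
triangle in the hyperbolic plane, so that `σ' s`, `τ' t` are the comparison points of `σ s`,
`τ t`. -/
structure IsCATNegOne (X : Type*) [MetricSpace X] : Prop where
  exists_segment : ∀ x y : X, ∃ S : Set X, IsSegment S x y
  comparison : ∀ (a b : ℝ) (σ τ : ℝ → X) (σ' τ' : ℝ → UpperHalfPlane),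
    0 ≤ a → 0 ≤ b →
    IsGeodesicOn σ 0 a → IsGeodesicOn τ 0 b → σ 0 = τ 0 →
    IsGeodesicOn σ' 0 a → IsGeodesicOn τ' 0 b → σ' 0 = τ' 0 →
    dist (σ a) (τ b) = dist (σ' a) (τ' b) →
    ∀ s ∈ Set.Icc 0 a, ∀ t ∈ Set.Icc 0 b, dist (σ s) (τ t) ≤ dist (σ' s) (τ' t)

/-- `δ`-hyperbolicity: every side of a geodesic triangle lies in the closed `δ`-neighborhood of the
union of the two other sides. -/
def IsDeltaHyperbolic (X : Type*) [MetricSpace X] (δ : ℝ) : Prop :=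
  ∀ (x y z : X) (S₁ S₂ S₃ : Set X), IsSegment S₁ x y → IsSegment S₂ y z → IsSegment S₃ x z →
    ∀ p ∈ S₁, ∃ q ∈ S₂ ∪ S₃, dist p q ≤ δ

/-! ### Hyperbolic isometries -/

/-- The translation length `|ψ| = inf_x d(x, ψ x)`. -/
noncomputable def translationLength {X : Type*} [MetricSpace X] (ψ : X ≃ᵢ X) : ℝ :=
  ⨅ x : X, dist x (ψ x)

/-- `ψ` is of hyperbolic type: its displacement function attains its infimum, and this infimum is
positive. -/
def IsHyperbolicIsometry {X : Type*} [MetricSpace X] (ψ : X ≃ᵢ X) : Prop :=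
  (∃ x : X, dist x (ψ x) = translationLength ψ) ∧ 0 < translationLength ψ

/-- `A` is a geodesic line which is invariant under `ψ`. -/
def IsInvariantLine {X : Type*} [MetricSpace X] (ψ : X ≃ᵢ X) (A : Set X) : Prop :=
  (∃ σ : ℝ → X, Isometry σ ∧ A = Set.range σ) ∧ ψ '' A = A

/-- `A` is the axis of `ψ`: the unique geodesic line invariant under `ψ`. -/
def IsAxis {X : Type*} [MetricSpace X] (ψ : X ≃ᵢ X) (A : Set X) : Prop :=
  IsInvariantLine ψ A ∧ ∀ B : Set X, IsInvariantLine ψ B → B = A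

/-- The closing property of a metric space `X` for a given closeness `ε₀`, with a lower bound `r`
for the translation length, and with constants `c₀`, `s₀`, `l₀`. It includes that the axis of `ψ`
exists and that `ψ` moves each of its points by `|ψ|`. -/
def HasClosingProperty (X : Type*) [MetricSpace X] (r ε₀ c₀ s₀ l₀ : ℝ) : Prop :=
  ∀ (l s : ℝ), l₀ ≤ l → s₀ < s →
    ∀ (γ : ℝ → X) (ψ : X ≃ᵢ X), IsGeodesicOn γ 0 (s + l) →
      IsHyperbolicIsometry ψ → r ≤ translationLength ψ →
      (∀ t ∈ Set.Icc 0 l, dist (γ (s + t)) (ψ (γ t)) ≤ ε₀) →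
      s - 2 * ε₀ ≤ translationLength ψ ∧ translationLength ψ ≤ s + ε₀ ∧
      ∃ A : Set X, IsAxis ψ A ∧ (∀ x ∈ A, dist x (ψ x) = translationLength ψ) ∧
        γ '' Set.Icc c₀ (s + l - c₀) ⊆ Metric.thickening (ε₀ / 8) A

/-! ### Real hyperbolic space -/

/-- Real hyperbolic space of dimension `m`, as the upper sheet of the hyperboloid
`time² - ‖space‖² = 1` in Minkowski space. -/
@[ext]
structure HyperbolicSpace (m : ℕ) where
  time : ℝ
  space : EuclideanSpace ℝ (Fin m)
  time_pos : 0 < time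
  time_sq : time ^ 2 = 1 + ‖space‖ ^ 2

namespace HyperbolicSpace

variable {m : ℕ}

/-- The negative of the Minkowski inner product. -/
noncomputable def form (x y : HyperbolicSpace m) : ℝ :=
  x.time * y.time - inner ℝ x.space y.space

/-- The spatial part of `x` after the Lorentz boost that moves `y` to the base point. -/
noncomputable def boost (y x : HyperbolicSpace m) : EuclideanSpace ℝ (Fin m) :=
  x.space - (x.time - inner ℝ x.space y.space / (1 + y.time)) • y.space

lemma inner_boost (x y z : HyperbolicSpace m) :
    inner ℝ (boost y x) (boost y z) = form x y * form y z - form x z := by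
  have h1 : (1 + y.time) ≠ 0 := by linarith [y.time_pos]
  have h2 : (inner ℝ y.space y.space : ℝ) = y.time ^ 2 - 1 := by
    rw [real_inner_self_eq_norm_sq, y.time_sq]; ring
  simp only [boost, form, inner_sub_left, inner_sub_right, real_inner_smul_left,
    real_inner_smul_right, h2, real_inner_comm y.space]
  rw [real_inner_comm z.space y.space]
  field_simp
  ring

lemma form_self (x : HyperbolicSpace m) : form x x = 1 := by
  rw [form, real_inner_self_eq_norm_sq, ← sq, x.time_sq]; ring

lemma form_comm (x y : HyperbolicSpace m) : form x y = form y x := by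
  simp only [form, mul_comm x.time, real_inner_comm x.space]

lemma norm_boost_sq (x y : HyperbolicSpace m) : ‖boost y x‖ ^ 2 = form x y ^ 2 - 1 := by
  rw [← real_inner_self_eq_norm_sq, inner_boost, form_self, form_comm y x]; ring

lemma norm_space_lt (x : HyperbolicSpace m) : ‖x.space‖ < x.time :=
  lt_of_pow_lt_pow_left₀ 2 x.time_pos.le (by linarith [x.time_sq])

lemma form_pos (x y : HyperbolicSpace m) : 0 < form x y := by
  have h1 := real_inner_le_norm x.space y.space
  have h2 := mul_lt_mul'' x.norm_space_lt y.norm_space_lt (norm_nonneg _) (norm_nonneg _)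
  rw [form]; linarith

lemma one_le_form (x y : HyperbolicSpace m) : 1 ≤ form x y := by
  nlinarith [norm_boost_sq x y, sq_nonneg ‖boost y x‖, form_pos x y]

lemma norm_boost (x y : HyperbolicSpace m) : ‖boost y x‖ = √(form x y ^ 2 - 1) := by
  rw [← norm_boost_sq, Real.sqrt_sq (norm_nonneg _)]

lemma eq_of_form_eq_one {x y : HyperbolicSpace m} (h : form x y = 1) : x = y := by
  have h0 : ‖boost y x‖ ^ 2 = 0 := by rw [norm_boost_sq, h]; ring
  have h1 : boost y x = 0 := by simpa using h0
  have hf : x.time * y.time - inner ℝ x.space y.space = 1 := h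
  have hy := y.time_pos
  have h2 : x.time - inner ℝ x.space y.space / (1 + y.time) = 1 := by
    have hb : 1 + y.time ≠ 0 := by linarith
    rw [boost, sub_eq_zero] at h1
    generalize hk : x.time - inner ℝ x.space y.space / (1 + y.time) = k at h1 ⊢
    have hi : inner ℝ x.space y.space = k * (y.time ^ 2 - 1) := by
      rw [h1, real_inner_smul_left, real_inner_self_eq_norm_sq, y.time_sq]; ring
    have ha : x.time = k * y.time := by
      rw [hi] at hk
      field_simp at hk
      have : (1 + y.time) * (x.time - k * y.time) = 0 := by linarith
      rcases mul_eq_zero.1 this with h' | h'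
      · exact absurd h' hb
      · linarith
    rw [hi, ha] at hf
    linarith
  have h3 : x.space = y.space := by
    rw [boost, h2, one_smul, sub_eq_zero] at h1; exact h1
  have h4 : x.time ^ 2 = y.time ^ 2 := by rw [x.time_sq, y.time_sq, h3]
  exact HyperbolicSpace.ext ((sq_eq_sq₀ x.time_pos.le hy.le).1 h4) h3

/-- The hyperbolic distance, given by `cosh d(x, y) = form x y`. -/
noncomputable instance : MetricSpace (HyperbolicSpace m) where
  dist x y := Real.arcosh (form x y)
  dist_self x := by rw [form_self]; exact Real.arcosh_zero
  dist_comm x y := by rw [form_comm]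
  dist_triangle x y z := by
    have hxy := one_le_form x y
    have hyz := one_le_form y z
    have hxz := one_le_form x z
    have h : form x z ≤ Real.cosh (Real.arcosh (form x y) + Real.arcosh (form y z)) := by
      rw [Real.cosh_add, Real.cosh_arcosh hxy, Real.cosh_arcosh hyz, Real.sinh_arcosh hxy,
        Real.sinh_arcosh hyz, ← norm_boost x y, form_comm y z, ← norm_boost z y]
      have h1 := neg_le_of_abs_le (abs_real_inner_le_norm (boost y x) (boost y z))
      rw [inner_boost, form_comm y z] at h1
      linarith
    have h2 := (Real.arcosh_le_arcosh (by linarith) (Real.cosh_pos _)).2 h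
    rwa [Real.arcosh_cosh (add_nonneg (Real.arcosh_nonneg hxy) (Real.arcosh_nonneg hyz))] at h2
  eq_of_dist_eq_zero {x y} h := eq_of_form_eq_one ((Real.arcosh_eq_zero_iff (one_le_form x y)).1 h)

end HyperbolicSpace

open Real Set Filter Topology

/-! The geometry enters through one inequality: along a geodesic, `cosh (dist · y)` lies below the
solution of `g'' = g` with the same endpoint values. In hyperbolic space this is an equality, and in
a CAT(-1) space it follows by comparison.

The inequality passes from points to lines: along a geodesic, `sinh` of the distance to a line is
again below such a solution (`sinh_infDist_le`), so on `[0, L]` it is at most `R * (exp (-t) + exp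
(-(L - t)))`, where `R` bounds the endpoint values. The bridge is `cosh_mul_cosh_le`, a first
variation argument at the foot of a perpendicular.

A hyperbolic isometry has an axis because minimal displacement doubles when the isometry is squared,
so the translates of a minimal segment fit together to a line. The axis is unique because the
distance between two invariant lines recurs arbitrarily far out on both sides while being
exponentially small in between.

For closing, let `f` be the distance of `γ` from the axis, which `ψ` preserves. The hypothesis at `t
= 0` and `t = l` gives `f 0 ≤ f s + ε` and `f (s + l) ≤ f l + ε`. Since `s` and `l` are interior
times, `f s` and `f l` are much smaller than the endpoint values, so those values satisfy a
contracting inequality and `R ≤ exp ε / 2`. Exponential decay then gives `f < ε / 8` at distance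
`c₀` from the ends. -/

/-- A geodesic space in which `cosh (dist · y)` is, along every geodesic, at most the solution of
`g'' = g` with the same values at the endpoints. -/
structure HasStewartInequality (X : Type*) [MetricSpace X] : Prop where
  exists_geodesic : ∀ x y : X, ∃ γ : ℝ → X,
    IsGeodesicOn γ 0 (dist x y) ∧ γ 0 = x ∧ γ (dist x y) = y
  stewart : ∀ (a : ℝ) (σ : ℝ → X), IsGeodesicOn σ 0 a → ∀ s ∈ Icc 0 a, ∀ y : X,
    sinh a * cosh (dist (σ s) y) ≤
      sinh (a - s) * cosh (dist (σ 0) y) + sinh s * cosh (dist (σ a) y)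

/-! ### Comparison triangles in the upper half plane -/

lemma halfPlaneRay_denom_pos {p q : ℝ} (h : p ^ 2 + q ^ 2 = 1) (t : ℝ) :
    0 < p ^ 2 + q ^ 2 * exp t ^ 2 := by
  have h0 := exp_pos t
  rcases eq_or_ne p 0 with rfl | hp
  · have : q ^ 2 = 1 := by simpa using h
    rw [this]; positivity
  · positivity

/-- The image of `exp t * I` under the Möbius transformation `z ↦ (p z + q) / (p - q z)`. -/
noncomputable def halfPlaneRay (p q : ℝ) (h : p ^ 2 + q ^ 2 = 1) (t : ℝ) : UpperHalfPlane :=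
  ⟨⟨p * q * (1 - exp t ^ 2) / (p ^ 2 + q ^ 2 * exp t ^ 2),
    exp t * (p ^ 2 + q ^ 2) / (p ^ 2 + q ^ 2 * exp t ^ 2)⟩, by
    have h0 := exp_pos t
    have := halfPlaneRay_denom_pos h t
    rw [h]
    positivity⟩

lemma cosh_eq_exp (x : ℝ) : cosh x = (exp x ^ 2 + 1) / (2 * exp x) := by
  have := exp_pos x
  rw [cosh_eq, exp_neg]; field_simp

lemma cosh_dist_halfPlaneRay {p q : ℝ} (h : p ^ 2 + q ^ 2 = 1) (s t : ℝ) :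
    cosh (dist (halfPlaneRay p q h s) (halfPlaneRay p q h t)) = cosh (s - t) := by
  have h1 := (halfPlaneRay_denom_pos h s).ne'
  have h2 := (halfPlaneRay_denom_pos h t).ne'
  have h3 := exp_pos s
  have h4 := exp_pos t
  have h5 : p ^ 2 + q ^ 2 ≠ 0 := by rw [h]; exact one_ne_zero
  rw [UpperHalfPlane.cosh_dist, Complex.dist_eq_re_im, sq_sqrt (by positivity), cosh_eq_exp, exp_sub]
  change 1 + ((p * q * (1 - exp s ^ 2) / (p ^ 2 + q ^ 2 * exp s ^ 2) -
      p * q * (1 - exp t ^ 2) / (p ^ 2 + q ^ 2 * exp t ^ 2)) ^ 2 +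
      (exp s * (p ^ 2 + q ^ 2) / (p ^ 2 + q ^ 2 * exp s ^ 2) -
      exp t * (p ^ 2 + q ^ 2) / (p ^ 2 + q ^ 2 * exp t ^ 2)) ^ 2) /
      (2 * (exp s * (p ^ 2 + q ^ 2) / (p ^ 2 + q ^ 2 * exp s ^ 2)) *
      (exp t * (p ^ 2 + q ^ 2) / (p ^ 2 + q ^ 2 * exp t ^ 2))) = _
  field_simp
  ring

/-- The hyperbolic law of cosines: the right side is `cosh s * cosh t - (p ^ 2 - q ^ 2) * sinh s *
sinh t`, so `p` and `q` are the cosine and sine of half the angle between the rays. -/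
lemma cosh_dist_halfPlaneRay_vertical {p q : ℝ} (h : p ^ 2 + q ^ 2 = 1) (s t : ℝ) :
    cosh (dist (halfPlaneRay 1 0 (by norm_num) s) (halfPlaneRay p q h t)) =
      p ^ 2 * cosh (t - s) + q ^ 2 * cosh (t + s) := by
  have h2 := (halfPlaneRay_denom_pos h t).ne'
  have h3 := exp_pos s
  have h4 := exp_pos t
  have h5 : p ^ 2 + q ^ 2 ≠ 0 := by rw [h]; exact one_ne_zero
  rw [UpperHalfPlane.cosh_dist, Complex.dist_eq_re_im, sq_sqrt (by positivity), cosh_eq_exp (t - s),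
    cosh_eq_exp (t + s), exp_sub, exp_add]
  change 1 + ((1 * 0 * (1 - exp s ^ 2) / (1 ^ 2 + 0 ^ 2 * exp s ^ 2) -
      p * q * (1 - exp t ^ 2) / (p ^ 2 + q ^ 2 * exp t ^ 2)) ^ 2 +
      (exp s * (1 ^ 2 + 0 ^ 2) / (1 ^ 2 + 0 ^ 2 * exp s ^ 2) -
      exp t * (p ^ 2 + q ^ 2) / (p ^ 2 + q ^ 2 * exp t ^ 2)) ^ 2) /
      (2 * (exp s * (1 ^ 2 + 0 ^ 2) / (1 ^ 2 + 0 ^ 2 * exp s ^ 2)) *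
      (exp t * (p ^ 2 + q ^ 2) / (p ^ 2 + q ^ 2 * exp t ^ 2))) = _
  -- Dividing by `p ^ 2 + q ^ 2 = 1` makes both sides homogeneous in `p`, `q`, so the claim becomes
  -- an identity of rational functions.
  have key (k : ℝ) : k = k / (p ^ 2 + q ^ 2) := by rw [h, div_one]
  rw [key (p ^ 2 * _ + q ^ 2 * _)]
  simp only [mul_zero, zero_mul, zero_sub, neg_sq, one_pow, ne_eq, OfNat.ofNat_ne_zero,
    not_false_eq_true, zero_pow, add_zero, mul_one, div_one]
  field_simp
  ring

lemma isGeodesicOn_halfPlaneRay {p q : ℝ} (h : p ^ 2 + q ^ 2 = 1) (a b : ℝ) :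
    IsGeodesicOn (halfPlaneRay p q h) a b := fun s _ t _ => by
  have := cosh_dist_halfPlaneRay h s t
  rw [← cosh_abs (s - t)] at this
  exact (cosh_strictMonoOn.injOn (mem_Ici.2 dist_nonneg) (mem_Ici.2 (abs_nonneg _)) this)

lemma halfPlaneRay_zero {p q : ℝ} (h : p ^ 2 + q ^ 2 = 1) :
    halfPlaneRay p q h 0 = UpperHalfPlane.I := by
  apply UpperHalfPlane.ext
  apply Complex.ext
  · change p * q * (1 - exp 0 ^ 2) / (p ^ 2 + q ^ 2 * exp 0 ^ 2) = 0
    simp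
  · change exp 0 * (p ^ 2 + q ^ 2) / (p ^ 2 + q ^ 2 * exp 0 ^ 2) = 1
    simp [h]

theorem IsCATNegOne.hasStewartInequality {X : Type*} [MetricSpace X] (hX : IsCATNegOne X) :
    HasStewartInequality X where
  exists_geodesic x y := by
    obtain ⟨S, γ, h1, h2, h3, -⟩ := hX.exists_segment x y
    exact ⟨γ, h1, h2, h3⟩
  stewart a σ hσ s hs y := by
    obtain ⟨S, τ, hτ, hτ0, hτb, -⟩ := hX.exists_segment (σ 0) y
    have ha : 0 ≤ a := hs.1.trans hs.2
    have hda : dist (σ 0) (σ a) = a := by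
      rw [hσ 0 ⟨le_rfl, ha⟩ a ⟨ha, le_rfl⟩, zero_sub, abs_neg, abs_of_nonneg ha]
    set b := dist (σ 0) y with hb
    set c := dist (σ a) y with hc
    have hb0 : 0 ≤ b := dist_nonneg
    have hc1 : cosh (b - a) ≤ cosh c := by
      rw [cosh_le_cosh, abs_of_nonneg (dist_nonneg : 0 ≤ c), abs_le]
      have h1 := dist_triangle (σ 0) (σ a) y
      have h2 := dist_triangle_right (σ 0) (σ a) y
      constructor <;> linarith
    have hc2 : cosh c ≤ cosh (b + a) := by
      rw [cosh_le_cosh, abs_of_nonneg (dist_nonneg : 0 ≤ c), abs_of_nonneg (by positivity)]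
      have := dist_triangle_left (σ a) y (σ 0)
      linarith
    -- The triangle inequality places `cosh c` between the values for angles `0` and `π`; the convex
    -- weights are the squared cosine and sine of half the comparison angle.
    have hseg : cosh c ∈ segment ℝ (cosh (b - a)) (cosh (b + a)) := by
      rw [segment_eq_Icc (hc1.trans hc2)]; exact ⟨hc1, hc2⟩
    obtain ⟨P, Q, hP, hQ, hPQ, hC⟩ := hseg
    have hpq : √P ^ 2 + √Q ^ 2 = 1 := by rw [sq_sqrt hP, sq_sqrt hQ, hPQ]
    have hcomp := hX.comparison a b σ τ (halfPlaneRay 1 0 (by norm_num)) (halfPlaneRay √P √Q hpq)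
      ha hb0 hσ hτ hτ0.symm (isGeodesicOn_halfPlaneRay _ _ _) (isGeodesicOn_halfPlaneRay _ _ _)
      (by rw [halfPlaneRay_zero, halfPlaneRay_zero])
      (by
        apply cosh_strictMonoOn.injOn (mem_Ici.2 dist_nonneg) (mem_Ici.2 dist_nonneg)
        rw [cosh_dist_halfPlaneRay_vertical, hτb, sq_sqrt hP, sq_sqrt hQ, ← hc, ← hC]
        simp)
      s hs b ⟨hb0, le_rfl⟩
    rw [hτb] at hcomp
    have h1 : cosh (dist (σ s) y) ≤ P * cosh (b - s) + Q * cosh (b + s) := by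
      have := cosh_le_cosh.2 ((abs_of_nonneg (dist_nonneg (x := σ s) (y := y))).le.trans
        (hcomp.trans (le_abs_self _)))
      rwa [cosh_dist_halfPlaneRay_vertical, sq_sqrt hP, sq_sqrt hQ] at this
    have h2 : sinh a * (P * cosh (b - s) + Q * cosh (b + s)) =
        sinh (a - s) * cosh b + sinh s * cosh c := by
      rw [← hC]
      simp only [smul_eq_mul]
      have hQ' : Q = 1 - P := by linarith
      subst hQ'
      rw [cosh_sub, cosh_add, sinh_sub, cosh_sub, cosh_add]
      ring
    rw [← h2]
    exact mul_le_mul_of_nonneg_left h1 (sinh_nonneg_iff.2 ha)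

/-! ### The hyperboloid model: geodesics and the Stewart equality -/

namespace HyperbolicSpace

variable {m : ℕ}

lemma cosh_dist (x y : HyperbolicSpace m) : cosh (dist x y) = form x y :=
  cosh_arcosh (one_le_form x y)

lemma sinh_dist (x y : HyperbolicSpace m) : sinh (dist x y) = ‖boost y x‖ := by
  rw [norm_boost]; exact sinh_arcosh (one_le_form x y)

/-- Equality in the triangle inequality is equality in Cauchy–Schwarz: seen from `p`, the points `x`
and `z` lie in opposite directions. The resulting linear relation is paired with the direction of
`y`. -/
lemma form_eq_of_dist_add {x p z : HyperbolicSpace m} (h : dist x p + dist p z = dist x z)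
    (y : HyperbolicSpace m) :
    sinh (dist x z) * form p y =
      sinh (dist p z) * form x y + sinh (dist x p) * form z y := by
  have h1 : (inner ℝ (boost p x) (boost p z) : ℝ) = -(sinh (dist x p) * sinh (dist p z)) := by
    rw [inner_boost, ← cosh_dist, ← cosh_dist, ← cosh_dist, ← h, cosh_add]; ring
  have hz : ‖boost p z‖ = sinh (dist p z) := by rw [dist_comm, sinh_dist]
  have h2 : sinh (dist p z) • boost p x + sinh (dist x p) • boost p z = 0 := by
    rw [← norm_eq_zero, ← sq_eq_zero_iff, norm_add_sq_real, norm_smul, norm_smul,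
      real_inner_smul_left, real_inner_smul_right, h1, hz, ← sinh_dist, norm_eq_abs, norm_eq_abs,
      mul_pow, mul_pow, sq_abs, sq_abs]
    ring
  have h3 := congrArg (fun v => (inner ℝ v (boost p y) : ℝ)) h2
  simp only [inner_add_left, real_inner_smul_left, inner_boost, inner_zero_left] at h3
  rw [← h, sinh_add]
  rw [← cosh_dist x p, ← cosh_dist z p, dist_comm z p] at h3
  linarith

/-- The point dividing the geodesic from `x` to `y` with weights `k`, `l`. -/
noncomputable def combination (x y : HyperbolicSpace m) (k l : ℝ) (hk : 0 ≤ k) (hl : 0 ≤ l)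
    (h : k ^ 2 + l ^ 2 + 2 * k * l * form x y = 1) : HyperbolicSpace m where
  time := k * x.time + l * y.time
  space := k • x.space + l • y.space
  time_pos := by
    have hx := x.time_pos
    have hy := y.time_pos
    rcases hk.eq_or_lt with rfl | hk
    · rcases hl.eq_or_lt with rfl | hl
      · norm_num at h
      · positivity
    · positivity
  time_sq := by
    rw [norm_add_sq_real, norm_smul, norm_smul, real_inner_smul_left, real_inner_smul_right,
      mul_pow, mul_pow, norm_eq_abs, norm_eq_abs, sq_abs, sq_abs]
    rw [form] at h
    linear_combination k ^ 2 * x.time_sq + l ^ 2 * y.time_sq + h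

lemma form_combination (x y z : HyperbolicSpace m) (k l : ℝ) (hk : 0 ≤ k) (hl : 0 ≤ l)
    (h : k ^ 2 + l ^ 2 + 2 * k * l * form x y = 1) :
    form (combination x y k l hk hl h) z = k * form x z + l * form y z := by
  simp only [form, combination, inner_add_left, real_inner_smul_left]; ring

lemma exists_geodesic (x y : HyperbolicSpace m) : ∃ γ : ℝ → HyperbolicSpace m,
    IsGeodesicOn γ 0 (dist x y) ∧ γ 0 = x ∧ γ (dist x y) = y := by
  rcases eq_or_ne x y with rfl | hne
  · refine ⟨fun _ => x, ?_, rfl, rfl⟩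
    intro s hs t ht
    simp only [dist_self, Icc_self, mem_singleton_iff] at hs ht
    simp [hs, ht]
  set a := dist x y with ha
  have ha0 : 0 < a := dist_pos.2 hne
  have hsa : 0 < sinh a := sinh_pos_iff.2 ha0
  have hk : ∀ s ∈ Icc 0 a, 0 ≤ sinh (a - s) / sinh a := fun s hs =>
    div_nonneg (sinh_nonneg_iff.2 (sub_nonneg.2 hs.2)) hsa.le
  have hl : ∀ s ∈ Icc 0 a, 0 ≤ sinh s / sinh a := fun s hs =>
    div_nonneg (sinh_nonneg_iff.2 hs.1) hsa.le
  -- The weights are the solutions of `g'' = g` with boundary values `1, 0` and `0, 1`; this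
  -- identity keeps the combination on the hyperboloid.
  have h : ∀ s, (sinh (a - s) / sinh a) ^ 2 + (sinh s / sinh a) ^ 2 +
      2 * (sinh (a - s) / sinh a) * (sinh s / sinh a) * form x y = 1 := fun s => by
    rw [← cosh_dist, ← ha]
    field_simp
    rw [sinh_sub]
    linear_combination -(sinh s ^ 2) * cosh_sq a + (sinh a ^ 2) * cosh_sq s
  classical
  let γ : ℝ → HyperbolicSpace m := fun s =>
    if hs : s ∈ Icc 0 a then combination x y _ _ (hk s hs) (hl s hs) (h s) else x
  have hγ : ∀ s (hs : s ∈ Icc 0 a), γ s = combination x y _ _ (hk s hs) (hl s hs) (h s) :=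
    fun s hs => dif_pos hs
  refine ⟨γ, ?_, ?_, ?_⟩
  · intro s hs t ht
    apply cosh_strictMonoOn.injOn (mem_Ici.2 dist_nonneg) (mem_Ici.2 (abs_nonneg _))
    rw [cosh_dist, hγ s hs, form_combination, form_comm, hγ t ht, form_combination,
      form_comm y (combination _ _ _ _ _ _ _),
      form_combination, form_self, form_self, form_comm y x, ← cosh_dist, ← ha, cosh_abs]
    field_simp
    rw [sinh_sub, sinh_sub, cosh_sub]
    linear_combination -(sinh t * sinh s) * cosh_sq a
  · have h0 : (0 : ℝ) ∈ Icc 0 a := ⟨le_rfl, ha0.le⟩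
    apply eq_of_form_eq_one
    rw [hγ 0 h0, form_combination, form_self]
    simp [hsa.ne']
  · have h0 : a ∈ Icc 0 a := ⟨ha0.le, le_rfl⟩
    apply eq_of_form_eq_one
    rw [hγ a h0, form_combination, form_self]
    simp [hsa.ne']

theorem hasStewartInequality (m : ℕ) : HasStewartInequality (HyperbolicSpace m) where
  exists_geodesic := exists_geodesic
  stewart a σ hσ s hs y := by
    have ha : 0 ≤ a := hs.1.trans hs.2
    have h1 : dist (σ 0) (σ s) = s := by
      rw [hσ 0 ⟨le_rfl, ha⟩ s hs, zero_sub, abs_neg, abs_of_nonneg hs.1]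
    have h2 : dist (σ s) (σ a) = a - s := by
      rw [hσ s hs a ⟨ha, le_rfl⟩, abs_sub_comm, abs_of_nonneg (sub_nonneg.2 hs.2)]
    have h3 : dist (σ 0) (σ a) = a := by
      rw [hσ 0 ⟨le_rfl, ha⟩ a ⟨ha, le_rfl⟩, zero_sub, abs_neg, abs_of_nonneg ha]
    have := form_eq_of_dist_add (x := σ 0) (p := σ s) (z := σ a) (by rw [h1, h2, h3]; ring) y
    rw [h1, h2, h3, ← cosh_dist, ← cosh_dist, ← cosh_dist] at this
    exact this.le

end HyperbolicSpace

/-! ### Elementary inequalities -/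

lemma nonneg_of_hasDerivAt_of_nonneg_right {Φ : ℝ → ℝ} {c u₀ : ℝ} (hu₀ : 0 < u₀)
    (hΦ : HasDerivAt Φ c 0) (h0 : Φ 0 = 0) (h : ∀ u ∈ Ioc 0 u₀, 0 ≤ Φ u) : 0 ≤ c := by
  have h1 : Tendsto (slope Φ 0) (𝓝[>] 0) (𝓝 c) :=
    (hasDerivAt_iff_tendsto_slope.1 hΦ).mono_left
      (nhdsWithin_mono _ fun x hx => (ne_of_gt hx : x ≠ 0))
  refine ge_of_tendsto h1 ?_
  filter_upwards [Ioc_mem_nhdsGT hu₀] with u hu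
  rw [slope_def_field, h0, sub_zero, sub_zero]
  exact div_nonneg (h u hu) hu.1.le

lemma IsGeodesicOn.dist_left {X : Type*} [MetricSpace X] {γ : ℝ → X} {a s : ℝ}
    (hγ : IsGeodesicOn γ 0 a) (hs : s ∈ Icc 0 a) : dist (γ 0) (γ s) = s := by
  rw [hγ 0 ⟨le_rfl, hs.1.trans hs.2⟩ s hs, zero_sub, abs_neg, abs_of_nonneg hs.1]

lemma IsGeodesicOn.dist_right {X : Type*} [MetricSpace X] {γ : ℝ → X} {a s : ℝ}
    (hγ : IsGeodesicOn γ 0 a) (hs : s ∈ Icc 0 a) : dist (γ s) (γ a) = a - s := by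
  rw [hγ s hs a ⟨hs.1.trans hs.2, le_rfl⟩, abs_sub_comm, abs_of_nonneg (sub_nonneg.2 hs.2)]

lemma cosh_le_cosh_of_le {x y : ℝ} (hx : 0 ≤ x) (h : x ≤ y) : cosh x ≤ cosh y := by
  rw [cosh_le_cosh, abs_of_nonneg hx, abs_of_nonneg (hx.trans h)]; exact h

lemma cosh_sub_le_cosh_of_dist {X : Type*} [MetricSpace X] (x y z : X) :
    cosh (dist x y - dist y z) ≤ cosh (dist x z) := by
  rw [cosh_le_cosh, abs_of_nonneg (dist_nonneg (x := x) (y := z)), abs_le]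
  have h1 := dist_triangle x z y
  have h2 := dist_triangle_left y z x
  rw [dist_comm z y] at h1
  constructor <;> linarith

/-- With `S = sinh u` and `sinh k = c S`, this bounds the distance between the points at distance
`u` and `k` from the vertex on the sides of an angle of cosine `c`. -/
lemma cosh_arsinh_mul_le {c u : ℝ} :
    cosh (arsinh (c * sinh u)) * cosh u - c * sinh u * sinh u * c ≤
      1 + (1 - c ^ 2) * sinh u ^ 2 / 2 := by
  have h1 : cosh (arsinh (c * sinh u)) ^ 2 = 1 + (c * sinh u) ^ 2 := by
    rw [cosh_sq, sinh_arsinh]; ring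
  have h2 := cosh_sq u
  nlinarith [sq_nonneg (cosh (arsinh (c * sinh u)) - cosh u)]

/-- For small `u` the hypothesis says that `e` is at most about `κ * u`. The two bounds lose nothing
to first order in `u`, which is all that a derivative at `0` sees. -/
lemma cosh_le_and_sinh_le_of_cosh_le {κ u e : ℝ} (hκ0 : 0 ≤ κ) (hκ1 : κ ^ 2 ≤ 1) (hu : 0 ≤ u)
    (hce : cosh e ≤ 1 + κ ^ 2 * sinh u ^ 2 / 2) :
    cosh e ≤ cosh u ^ 2 ∧ sinh e ≤ κ * (sinh u * cosh u) := by
  have hcu : cosh u ^ 2 = sinh u ^ 2 + 1 := cosh_sq u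
  have hsu : 0 ≤ sinh u := sinh_nonneg_iff.2 hu
  have hS2 : κ ^ 2 * sinh u ^ 2 ≤ sinh u ^ 2 := mul_le_of_le_one_left (sq_nonneg _) hκ1
  have h4 : 0 ≤ κ ^ 2 * sinh u ^ 2 := by positivity
  refine ⟨by linarith, le_of_sq_le_sq ?_ (by have := cosh_pos u; positivity)⟩
  have h1 : sinh e ^ 2 = (cosh e - 1) * (cosh e + 1) := by rw [sinh_sq]; ring
  have h2 : (κ * (sinh u * cosh u)) ^ 2 = κ ^ 2 * sinh u ^ 2 * (sinh u ^ 2 + 1) := by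
    rw [mul_pow, mul_pow, hcu]; ring
  rw [h1, h2]
  have h3 := one_le_cosh e
  calc (cosh e - 1) * (cosh e + 1)
      ≤ (κ ^ 2 * sinh u ^ 2 / 2) * (κ ^ 2 * sinh u ^ 2 / 2 + 2) :=
        mul_le_mul (by linarith) (by linarith) (by linarith) (by linarith)
    _ = κ ^ 2 * sinh u ^ 2 * (κ ^ 2 * sinh u ^ 2 / 4 + 1) := by ring
    _ ≤ _ := mul_le_mul_of_nonneg_left (by linarith) h4

/-! ### First variation at the foot of a perpendicular -/

namespace HasStewartInequality

variable {X : Type*} [MetricSpace X]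

/-- If `τ 0` is the point of the geodesic `τ` nearest to `z`, the angle at `τ 0` is at least
`π / 2`; in the hyperbolic plane with a right angle at `τ 0` and `τ M` the foot of `y`,
equality holds. -/
lemma cosh_mul_cosh_le (hX : HasStewartInequality X) (z y : X) {τ : ℝ → X} {M : ℝ} (hM : 0 ≤ M)
    (hτ : IsGeodesicOn τ 0 M) (hfoot : ∀ k ∈ Icc 0 M, dist z (τ 0) ≤ dist z (τ k)) :
    cosh (dist z (τ 0)) * cosh (dist y (τ 0)) ≤
      cosh (dist z y) + sinh (dist z (τ 0)) * sinh (dist y (τ M)) := by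
  obtain ⟨η, hη, hη0, hηD⟩ := hX.exists_geodesic (τ 0) y
  rw [dist_comm y (τ 0)]
  set r := dist z (τ 0) with hr
  set D := dist (τ 0) y with hD
  set f := dist y (τ M) with hf
  set h := dist z y with hh
  have hr0 : 0 ≤ r := dist_nonneg
  have hsr : 0 ≤ sinh r := sinh_nonneg_iff.2 hr0
  have hD0 : 0 ≤ D := dist_nonneg
  have hf0 : 0 ≤ f := dist_nonneg
  rcases le_or_gt D f with hDf | hfD
  · have h1 : cosh (r - D) ≤ cosh h := cosh_sub_le_cosh_of_dist z (τ 0) y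
    rw [cosh_sub] at h1
    have h2 := mul_le_mul_of_nonneg_left (sinh_le_sinh.2 hDf) hsr
    linarith
  have hDpos : 0 < D := hf0.trans_lt hfD
  have hMpos : 0 < M := by
    rcases hM.eq_or_lt with rfl | hM
    · rw [hf, hD, dist_comm] at hfD; exact absurd hfD (lt_irrefl _)
    · exact hM
  have hsD : 0 < sinh D := sinh_pos_iff.2 hDpos
  have hsM : 0 < sinh M := sinh_pos_iff.2 hMpos
  -- Below, `c` and `κ` are the cosine and sine of the comparison angle at `τ 0` between `τ` and
  -- `η`.
  have hdM : dist (τ M) (τ 0) = M := by rw [dist_comm]; exact hτ.dist_left ⟨hM, le_rfl⟩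
  set c := (cosh M * cosh D - cosh f) / (sinh M * sinh D) with hc
  have hcmul : c * (sinh M * sinh D) = cosh M * cosh D - cosh f :=
    div_mul_cancel₀ _ (by positivity)
  have hc0 : 0 ≤ c := by
    refine div_nonneg ?_ (by positivity)
    have h1 := cosh_le_cosh_of_le hf0 hfD.le
    have h2 := one_le_cosh M
    nlinarith [one_le_cosh D]
  have hc1 : c ≤ 1 := by
    rw [hc, div_le_one (by positivity)]
    have h1 := cosh_sub_le_cosh_of_dist (τ M) (τ 0) y
    rw [hdM, ← hD, dist_comm, ← hf, cosh_sub] at h1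
    linarith
  set κ := √(1 - c ^ 2) with hκ
  have hκ2 : κ ^ 2 = 1 - c ^ 2 := sq_sqrt (by nlinarith)
  have hκ0 : 0 ≤ κ := sqrt_nonneg _
  -- In the comparison triangle, `κ * sinh D` is `sinh` of the distance from `y` to the line
  -- carrying the side `τ`, hence at most `sinh f`.
  have hκf : κ * sinh D ≤ sinh f := by
    refine le_of_sq_le_sq ?_ (sinh_nonneg_iff.2 hf0)
    have h1 : (κ * sinh D) ^ 2 * sinh M ^ 2 =
        sinh D ^ 2 * sinh M ^ 2 - (c * (sinh M * sinh D)) ^ 2 := by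
      rw [mul_pow, hκ2]; ring
    rw [hcmul] at h1
    have h2 : (κ * sinh D) ^ 2 * sinh M ^ 2 ≤ sinh f ^ 2 * sinh M ^ 2 := by
      rw [h1]
      simp only [sinh_sq]
      nlinarith [sq_nonneg (cosh D - cosh f * cosh M)]
    exact le_of_mul_le_mul_right h2 (by positivity)
  -- `C` is `sinh r` times the cosine of the comparison angle at `τ 0` between `z` and `y`. It
  -- remains to show `C ≤ κ * sinh r`: this angle and the one between `τ` and `η` add up to at least
  -- `π / 2`.
  set C := (cosh r * cosh D - cosh h) / sinh D with hC
  have hCmul : C * sinh D = cosh r * cosh D - cosh h := div_mul_cancel₀ _ hsD.ne'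
  -- `Φ u` bounds from above `cosh` of the length of the path from `z` via `η u` to `τ k`, minus
  -- `cosh r`. It is nonnegative because `τ 0` is nearest to `z`, and it vanishes at `0`, so its
  -- derivative there is nonnegative.
  let Φ : ℝ → ℝ := fun u => (cosh r * cosh u - C * sinh u) * cosh u ^ 2 +
    sinh (r + u) * (κ * (sinh u * cosh u)) - cosh r
  have hΦ : HasDerivAt Φ (-C + κ * sinh r) 0 := by
    have e1 := (((hasDerivAt_cosh 0).const_mul (cosh r)).sub ((hasDerivAt_sinh 0).const_mul C)).mul
      ((hasDerivAt_cosh 0).pow 2)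
    have e2 := ((hasDerivAt_sinh (r + 0)).comp (0 : ℝ) ((hasDerivAt_id (0 : ℝ)).const_add r)).mul
      (((hasDerivAt_sinh 0).mul (hasDerivAt_cosh 0)).const_mul κ)
    refine ((e1.add e2).sub_const (cosh r)).congr_deriv ?_
    simp [mul_comm]
  have hpos : 0 ≤ -C + κ * sinh r := by
    refine nonneg_of_hasDerivAt_of_nonneg_right (lt_min hDpos hMpos) hΦ (by simp [Φ]) ?_
    rintro u ⟨hu, hu'⟩
    have huD : u ∈ Icc 0 D := ⟨hu.le, hu'.trans (min_le_left _ _)⟩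
    have hsu : 0 < sinh u := sinh_pos_iff.2 hu
    -- To first order this is `c * u`, the foot of `η u` on `τ`; taking `sinh k = c * sinh u` keeps
    -- the estimates algebraic.
    set k := arsinh (c * sinh u) with hk
    have hsk : sinh k = c * sinh u := sinh_arsinh _
    have hkM : k ∈ Icc 0 M := by
      constructor
      · rw [← sinh_nonneg_iff, hsk]; positivity
      · have : k ≤ u := by rw [← sinh_le_sinh, hsk]; nlinarith
        exact this.trans (hu'.trans (min_le_right _ _))
    have hv0 : dist (τ 0) (η u) = u := by rw [← hη0]; exact hη.dist_left huD
    have hzv : cosh (dist z (η u)) ≤ cosh r * cosh u - C * sinh u := by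
      have := hX.stewart D η hη u huD z
      rw [hηD, hη0, dist_comm (η u), dist_comm (τ 0), dist_comm y, ← hr, ← hh, sinh_sub] at this
      refine le_of_mul_le_mul_left (this.trans (le_of_eq ?_)) hsD
      linear_combination sinh u * hCmul
    have hpv : sinh D * cosh (dist (η u) (τ M)) ≤
        sinh (D - u) * cosh M + sinh u * cosh f := by
      have := hX.stewart D η hη u huD (τ M)
      rwa [hηD, hη0, hτ.dist_left ⟨hM, le_rfl⟩] at this
    set e := dist (η u) (τ k) with he
    have he0 : 0 ≤ e := dist_nonneg
    have hce : cosh e ≤ 1 + (1 - c ^ 2) * sinh u ^ 2 / 2 := by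
      refine le_trans ?_ (cosh_arsinh_mul_le (c := c) (u := u))
      rw [← hk]
      have := hX.stewart M τ hτ k hkM (η u)
      rw [hv0, dist_comm (τ k), ← he, dist_comm (τ M), sinh_sub, hsk] at this
      refine le_of_mul_le_mul_left ?_ (mul_pos hsD hsM)
      have h1 := mul_le_mul_of_nonneg_left this hsD.le
      have h2 := mul_le_mul_of_nonneg_left hpv (mul_nonneg hc0 hsu.le)
      rw [sinh_sub] at h2
      have h3 : sinh D * sinh M * (cosh k * cosh u - c * sinh u * sinh u * c) =
        sinh D * sinh M * (cosh k * cosh u) -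
          c * sinh u * sinh u * (cosh M * cosh D - cosh f) := by rw [← hcmul]; ring
      rw [h3]
      linarith
    rw [← hκ2] at hce
    obtain ⟨hce2, hse⟩ := cosh_le_and_sinh_le_of_cosh_le hκ0
      (by rw [hκ2]; linarith [sq_nonneg c]) hu.le hce
    have hrle : r ≤ dist z (η u) + e := (hfoot k hkM).trans (dist_triangle _ _ _)
    have h1 := cosh_le_cosh_of_le hr0 hrle
    rw [cosh_add] at h1
    have h2 : sinh (dist z (η u)) ≤ sinh (r + u) := by
      rw [sinh_le_sinh]
      exact (dist_triangle z (τ 0) (η u)).trans (by rw [hv0])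
    have h3 : cosh (dist z (η u)) * cosh e ≤ (cosh r * cosh u - C * sinh u) * cosh u ^ 2 :=
      mul_le_mul hzv hce2 (cosh_pos _).le ((cosh_pos _).le.trans hzv)
    have h4 : sinh (dist z (η u)) * sinh e ≤ sinh (r + u) * (κ * (sinh u * cosh u)) :=
      mul_le_mul h2 hse (sinh_nonneg_iff.2 he0) (sinh_nonneg_iff.2 (by positivity))
    change 0 ≤ _ + _ - _
    linarith
  have h1 : C * sinh D ≤ sinh r * sinh f := by
    have := mul_le_mul_of_nonneg_left hκf hsr
    nlinarith
  linarith

end HasStewartInequality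

/-! ### Distance to a geodesic line -/

lemma Isometry.exists_infDist_range_eq {X : Type*} [MetricSpace X] {σ : ℝ → X} (hσ : Isometry σ)
    (z : X) : ∃ u, Metric.infDist z (range σ) = dist z (σ u) := by
  have hc : Continuous fun u => dist z (σ u) := continuous_const.dist hσ.continuous
  have ht : Tendsto (fun u => dist z (σ u)) (cocompact ℝ) atTop := by
    refine tendsto_atTop_mono (f := fun u => ‖u‖ - dist z (σ 0)) (fun u => ?_)
      (tendsto_atTop_add_const_right _ _ (tendsto_norm_cocompact_atTop (E := ℝ)))
    have h1 := dist_triangle_left (σ u) (σ 0) z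
    rw [hσ.dist_eq, dist_zero_right] at h1
    linarith
  obtain ⟨u, hu⟩ := hc.exists_forall_le ht
  refine ⟨u, le_antisymm (Metric.infDist_le_dist_of_mem (mem_range_self u)) ?_⟩
  rw [Metric.le_infDist (range_nonempty σ)]
  rintro _ ⟨v, rfl⟩
  exact hu v

lemma sinh_add_sinh_le {t L : ℝ} (ht : t ∈ Icc 0 L) :
    sinh (L - t) + sinh t ≤ (exp (-t) + exp (-(L - t))) * sinh L := by
  obtain ⟨b, hb⟩ : ∃ b, b = L - t := ⟨_, rfl⟩
  have hL : L = t + b := by linarith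
  have hb0 : 0 ≤ b := by linarith [ht.2]
  rw [← hb, hL, sinh_eq, sinh_eq, sinh_eq, neg_add, exp_add, exp_add]
  have h1 : exp t * exp (-t) = 1 := by rw [← exp_add]; simp
  have h2 : exp b * exp (-b) = 1 := by rw [← exp_add]; simp
  have h3 : exp (-t) ≤ 1 := exp_le_one_iff.2 (by linarith [ht.1])
  have h4 : exp (-b) ≤ 1 := exp_le_one_iff.2 (by linarith)
  have h5 := exp_pos (-t)
  have h6 := exp_pos (-b)
  have key : (exp (-t) + exp (-b)) * ((exp t * exp b - exp (-t) * exp (-b)) / 2) =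
      (exp b + exp t - exp (-t) ^ 2 * exp (-b) - exp (-t) * exp (-b) ^ 2) / 2 := by
    linear_combination (exp b / 2) * h1 + (exp t / 2) * h2
  rw [key]
  have h7 : exp (-t) ^ 2 * exp (-b) ≤ exp (-b) :=
    mul_le_of_le_one_left h6.le (pow_le_one₀ h5.le h3)
  have h8 : exp (-t) * exp (-b) ^ 2 ≤ exp (-t) :=
    mul_le_of_le_one_right h5.le (pow_le_one₀ h6.le h4)
  linarith

namespace HasStewartInequality

variable {X : Type*} [MetricSpace X]

lemma cosh_infDist_mul_cosh_le (hX : HasStewartInequality X) {σ : ℝ → X} (hσ : Isometry σ)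
    (z y : X) {u : ℝ} (hu : Metric.infDist z (range σ) = dist z (σ u)) :
    cosh (Metric.infDist z (range σ)) * cosh (dist y (σ u)) ≤
      cosh (dist z y) + sinh (Metric.infDist z (range σ)) * sinh (Metric.infDist y (range σ)) := by
  obtain ⟨v, hv⟩ := hσ.exists_infDist_range_eq y
  have hfoot : ∀ w, dist z (σ u) ≤ dist z (σ w) := fun w =>
    hu ▸ Metric.infDist_le_dist_of_mem (mem_range_self w)
  rw [hv, hu]
  -- The line is traversed from the foot of `z` towards the foot of `y`, in whichever direction that
  -- is.
  rcases le_total u v with h | h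
  · have := hX.cosh_mul_cosh_le z y (τ := fun k => σ (u + k)) (sub_nonneg.2 h)
      (fun s _ t _ => by rw [hσ.dist_eq, dist_add_left, dist_eq])
      (fun k _ => by simpa using hfoot (u + k))
    simpa using this
  · have := hX.cosh_mul_cosh_le z y (τ := fun k => σ (u - k)) (sub_nonneg.2 h)
      (fun s _ t _ => by rw [hσ.dist_eq, dist_sub_left, dist_eq])
      (fun k _ => by simpa using hfoot (u - k))
    simpa using this

/-- The hyperbolic sine of the distance to a line is, along a geodesic, at most the solution of
`g'' = g` with the same values at the endpoints. -/
lemma sinh_infDist_le (hX : HasStewartInequality X) {σ : ℝ → X} (hσ : Isometry σ) {γ : ℝ → X}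
    {L t : ℝ} (hγ : IsGeodesicOn γ 0 L) (ht : t ∈ Icc 0 L) :
    sinh L * sinh (Metric.infDist (γ t) (range σ)) ≤
      sinh (L - t) * sinh (Metric.infDist (γ 0) (range σ)) +
        sinh t * sinh (Metric.infDist (γ L) (range σ)) := by
  obtain ⟨u, hu⟩ := hσ.exists_infDist_range_eq (γ t)
  have h1 := hX.stewart L γ hγ t ht (σ u)
  have h2 := hX.cosh_infDist_mul_cosh_le hσ (γ t) (γ 0) hu
  have h3 := hX.cosh_infDist_mul_cosh_le hσ (γ t) (γ L) hu
  rw [dist_comm (γ t), hγ.dist_left ht] at h2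
  rw [hγ.dist_right ht] at h3
  rw [← hu] at h1
  have hf : ∀ x, 0 ≤ sinh (Metric.infDist x (range σ)) :=
    fun x => sinh_nonneg_iff.2 Metric.infDist_nonneg
  have ht0 : 0 ≤ sinh t := sinh_nonneg_iff.2 ht.1
  have hLt : 0 ≤ sinh (L - t) := sinh_nonneg_iff.2 (sub_nonneg.2 ht.2)
  set r := Metric.infDist (γ t) (range σ)
  rcases (hf (γ t)).eq_or_lt with hr | hr
  · rw [← hr, mul_zero]
    exact add_nonneg (mul_nonneg hLt (hf _)) (mul_nonneg ht0 (hf _))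
  -- After multiplication by `cosh r`, the addition formula produces `sinh L`, which cancels the `1`
  -- in `cosh r ^ 2 = 1 + sinh r ^ 2`; a factor `sinh r` then divides out.
  refine le_of_mul_le_mul_left ?_ hr
  have h4 := mul_le_mul_of_nonneg_left h1 (cosh_pos r).le
  have h5 := mul_le_mul_of_nonneg_left h2 hLt
  have h6 := mul_le_mul_of_nonneg_left h3 ht0
  have h7 : sinh L = sinh (L - t) * cosh t + cosh (L - t) * sinh t := by
    rw [← sinh_add]; ring_nf
  have h8 : cosh r * (sinh L * cosh r) = sinh L * sinh r ^ 2 + sinh L := by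
    linear_combination sinh L * cosh_sq r
  linarith

lemma sinh_infDist_le_exp (hX : HasStewartInequality X) {σ : ℝ → X} (hσ : Isometry σ) {γ : ℝ → X}
    {L t R : ℝ} (hL : 0 < L) (hγ : IsGeodesicOn γ 0 L) (ht : t ∈ Icc 0 L)
    (h0 : sinh (Metric.infDist (γ 0) (range σ)) ≤ R)
    (h1 : sinh (Metric.infDist (γ L) (range σ)) ≤ R) :
    sinh (Metric.infDist (γ t) (range σ)) ≤ R * (exp (-t) + exp (-(L - t))) := by
  have hR : 0 ≤ R := (sinh_nonneg_iff.2 Metric.infDist_nonneg).trans h0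
  refine le_of_mul_le_mul_left ?_ (sinh_pos_iff.2 hL)
  calc _ ≤ _ := hX.sinh_infDist_le hσ hγ ht
    _ ≤ sinh (L - t) * R + sinh t * R :=
      add_le_add (mul_le_mul_of_nonneg_left h0 (sinh_nonneg_iff.2 (sub_nonneg.2 ht.2)))
        (mul_le_mul_of_nonneg_left h1 (sinh_nonneg_iff.2 ht.1))
    _ = R * (sinh (L - t) + sinh t) := by ring
    _ ≤ R * ((exp (-t) + exp (-(L - t))) * sinh L) :=
      mul_le_mul_of_nonneg_left (sinh_add_sinh_le ht) hR
    _ = _ := by ring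

/-! ### Existence and uniqueness of the axis -/

/-- The segment joining the midpoints of `[x, φ x]` and `[φ x, φ (φ x)]` is at least as long as the
minimal displacement of `φ`. -/
lemma two_mul_le_dist_apply_apply (hX : HasStewartInequality X) (φ : X ≃ᵢ X) {T : ℝ} (hT : 0 ≤ T)
    (h : ∀ x, T ≤ dist x (φ x)) (x : X) : 2 * T ≤ dist x (φ (φ x)) := by
  obtain ⟨γ, hγ, hγ0, hγe⟩ := hX.exists_geodesic x (φ x)
  set e := dist x (φ x) with he
  have heT : T ≤ e := h x
  rcases hT.eq_or_lt with rfl | hTpos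
  · simp
  have he2 : e / 2 ∈ Icc 0 e := ⟨by linarith, by linarith⟩
  set m := γ (e / 2)
  set c := dist x (φ (φ x)) with hc
  have hmy : dist m (φ x) = e / 2 := by rw [← hγe, hγ.dist_right he2]; ring
  have hse : 0 < sinh (e / 2) := sinh_pos_iff.2 (by linarith)
  have hsin : sinh e = sinh (e / 2) * (2 * cosh (e / 2)) := by
    have := sinh_two_mul (e / 2)
    rw [mul_div_cancel₀ _ (two_ne_zero)] at this
    rw [this]; ring
  have hcos : cosh e = 2 * cosh (e / 2) ^ 2 - 1 := by
    have := cosh_two_mul (e / 2)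
    rw [mul_div_cancel₀ _ (two_ne_zero)] at this
    rw [this, sinh_sq]; ring
  have key : ∀ w, 2 * cosh (e / 2) * cosh (dist m w) ≤ cosh (dist x w) + cosh (dist (φ x) w) := by
    intro w
    have := hX.stewart e γ hγ (e / 2) he2 w
    rw [hγ0, hγe, sub_half, hsin] at this
    refine le_of_mul_le_mul_left ?_ hse
    linarith
  -- With `w = φ (φ x)` the midpoint inequality bounds `dist m (φ (φ x))` through `c`; with `w =
  -- φ.symm m` it bounds `dist m (φ m)` through `dist m (φ (φ x))`. The latter is eliminated.
  have h1 := key (φ (φ x))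
  rw [φ.dist_eq, ← he, ← hc, hcos] at h1
  have h2 := key (φ.symm m)
  have e1 : dist m (φ.symm m) = dist m (φ m) := by
    rw [← φ.dist_eq, φ.apply_symm_apply, dist_comm]
  have e2 : dist x (φ.symm m) = e / 2 := by
    rw [← φ.dist_eq, φ.apply_symm_apply, dist_comm, hmy]
  have e3 : dist (φ x) (φ.symm m) = dist m (φ (φ x)) := by
    rw [← φ.dist_eq, φ.apply_symm_apply, dist_comm]
  rw [e1, e2, e3] at h2
  have hch := cosh_pos (e / 2)
  have h3 : 4 * cosh (e / 2) ^ 2 * (cosh (dist m (φ m)) - 1) ≤ cosh c - 1 := by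
    have := mul_le_mul_of_nonneg_left h2 (by positivity : 0 ≤ 2 * cosh (e / 2))
    linarith
  have h4 : cosh T ≤ cosh (dist m (φ m)) := cosh_le_cosh_of_le hT (h m)
  have h5 : cosh (T / 2) ≤ cosh (e / 2) := cosh_le_cosh_of_le (by linarith) (by linarith)
  -- This is the equality case of `h3`, with `e`, `dist m (φ m)` and `c` equal to `T`, `T` and `2 *
  -- T`; monotonicity does the rest.
  have h6 : cosh (2 * T) - 1 = 4 * cosh (T / 2) ^ 2 * (cosh T - 1) := by
    have h7 : cosh T = 2 * cosh (T / 2) ^ 2 - 1 := by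
      have := cosh_two_mul (T / 2)
      rw [mul_div_cancel₀ _ (two_ne_zero)] at this
      rw [this, sinh_sq]; ring
    rw [cosh_two_mul, sinh_sq, h7]
    ring
  have h8 : cosh (2 * T) ≤ cosh c := by
    have h9 : 4 * cosh (T / 2) ^ 2 * (cosh T - 1) ≤
        4 * cosh (e / 2) ^ 2 * (cosh (dist m (φ m)) - 1) := by
      have := cosh_pos (T / 2)
      have := one_le_cosh T
      gcongr
    linarith
  rw [cosh_le_cosh, abs_of_nonneg (by linarith), abs_of_nonneg dist_nonneg] at h8
  exact h8

end HasStewartInequality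

lemma translationLength_le {X : Type*} [MetricSpace X] (ψ : X ≃ᵢ X) (x : X) :
    translationLength ψ ≤ dist x (ψ x) :=
  ciInf_le ⟨0, by rintro _ ⟨y, rfl⟩; exact dist_nonneg⟩ x

namespace HasStewartInequality

variable {X : Type*} [MetricSpace X]

lemma two_pow_mul_le_dist (hX : HasStewartInequality X) (ψ : X ≃ᵢ X) {T : ℝ} (hT : 0 ≤ T)
    (h : ∀ x, T ≤ dist x (ψ x)) (k : ℕ) (x : X) : 2 ^ k * T ≤ dist x ((ψ ^ 2 ^ k) x) := by
  induction k generalizing x with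
  | zero => simpa using h x
  | succ k ih =>
    have := hX.two_mul_le_dist_apply_apply (ψ ^ 2 ^ k) (by positivity) ih x
    rw [← IsometryEquiv.mul_apply, ← pow_two, ← pow_mul, ← pow_succ] at this
    rw [pow_succ (2 : ℝ)]
    linarith

lemma dist_pow_le (ψ : X ≃ᵢ X) (x : X) (n : ℕ) : dist x ((ψ ^ n) x) ≤ n * dist x (ψ x) := by
  induction n with
  | zero => simp
  | succ n ih =>
    have h1 := dist_triangle x ((ψ ^ n) x) ((ψ ^ (n + 1)) x)
    rw [pow_succ, IsometryEquiv.mul_apply, IsometryEquiv.dist_eq] at h1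
    push_cast
    rw [pow_succ, IsometryEquiv.mul_apply]
    linarith

/-- Doubling gives the lower bound at the exponent `2 ^ n`, which exceeds `n`. The remaining `2 ^ n
- n` steps cost at most one minimal displacement each, so the first `n` cannot fall short. -/
lemma dist_pow_eq (hX : HasStewartInequality X) (ψ : X ≃ᵢ X) {x : X}
    (hx : ∀ y, dist x (ψ x) ≤ dist y (ψ y)) (n : ℕ) :
    dist x ((ψ ^ n) x) = n * dist x (ψ x) := by
  refine le_antisymm (dist_pow_le ψ x n) ?_
  obtain ⟨d, hd⟩ := Nat.exists_eq_add_of_le (Nat.lt_two_pow_self (n := n)).le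
  have h1 := hX.two_pow_mul_le_dist ψ dist_nonneg hx n x
  have h2 := dist_triangle x ((ψ ^ n) x) ((ψ ^ 2 ^ n) x)
  have h3 : dist ((ψ ^ n) x) ((ψ ^ 2 ^ n) x) ≤ d * dist x (ψ x) := by
    rw [hd, pow_add, IsometryEquiv.mul_apply, IsometryEquiv.dist_eq]
    exact dist_pow_le ψ x d
  have h4 : (2 : ℝ) ^ n = n + d := by exact_mod_cast hd
  rw [h4] at h1
  linarith

lemma dist_zpow_eq (hX : HasStewartInequality X) (ψ : X ≃ᵢ X) {x : X}
    (hx : ∀ y, dist x (ψ x) ≤ dist y (ψ y)) {i j : ℤ} (hij : i ≤ j) :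
    dist ((ψ ^ i) x) ((ψ ^ j) x) = (j - i) * dist x (ψ x) := by
  obtain ⟨n, rfl⟩ := Int.le.dest hij
  rw [zpow_add, IsometryEquiv.mul_apply, IsometryEquiv.dist_eq, zpow_natCast,
    hX.dist_pow_eq ψ hx n]
  push_cast
  ring

/-- The translates of a geodesic from a point `x` of minimal displacement to `ψ x` form a
1-Lipschitz curve. It attains the full distance between orbit points arbitrarily far apart, so no
piece in between can be shorter than its parameter length. -/
lemma exists_isometry_translated (hX : HasStewartInequality X) {ψ : X ≃ᵢ X}
    (hψ : IsHyperbolicIsometry ψ) :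
    ∃ σ : ℝ → X, Isometry σ ∧ ∀ t, ψ (σ t) = σ (t + translationLength ψ) := by
  obtain ⟨⟨x, hxT⟩, hT⟩ := hψ
  have hx : ∀ y, dist x (ψ x) ≤ dist y (ψ y) := fun y => hxT ▸ translationLength_le ψ y
  obtain ⟨γ, hγ, hγ0, hγT⟩ := hX.exists_geodesic x (ψ x)
  have hzpow := fun i j => hX.dist_zpow_eq ψ hx (i := i) (j := j)
  rw [hxT] at hγ hγT hzpow
  set T := translationLength ψ with hTdef
  let σ : ℝ → X := fun t => (ψ ^ ⌊t / T⌋) (γ (T * Int.fract (t / T)))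
  have hmem : ∀ t, T * Int.fract (t / T) ∈ Icc 0 T := fun t =>
    ⟨mul_nonneg hT.le (Int.fract_nonneg _),
      mul_le_of_le_one_right hT.le (Int.fract_lt_one _).le⟩
  have hdecomp : ∀ t, T * Int.fract (t / T) = t - ⌊t / T⌋ * T := fun t => by
    rw [Int.fract]; field_simp
  have hint : ∀ n : ℤ, σ (n * T) = (ψ ^ n) x := fun n => by
    simp only [σ, mul_div_cancel_right₀ _ hT.ne', Int.floor_intCast, Int.fract_intCast, mul_zero,
      hγ0]
  have hlip : ∀ s t, s ≤ t → dist (σ s) (σ t) ≤ t - s := by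
    intro s t hst
    have hs := hmem s
    have ht := hmem t
    rcases (Int.floor_le_floor (div_le_div_of_nonneg_right hst hT.le)).eq_or_lt with hmn | hmn
    · simp only [σ]
      rw [← hmn, IsometryEquiv.dist_eq, hγ _ hs _ ht, hdecomp, hdecomp, ← hmn, abs_sub_comm,
        abs_of_nonneg (by linarith)]
      linarith
    · have h1 : dist (σ s) ((ψ ^ (⌊s / T⌋ + 1)) x) = T - T * Int.fract (s / T) := by
        rw [zpow_add_one, IsometryEquiv.mul_apply]
        simp only [σ]
        rw [IsometryEquiv.dist_eq, ← hγT, hγ.dist_right hs]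
      have h2 : dist ((ψ ^ ⌊t / T⌋) x) (σ t) = T * Int.fract (t / T) := by
        simp only [σ]
        rw [IsometryEquiv.dist_eq, ← hγ0, hγ.dist_left ht]
      have h3 := hzpow (⌊s / T⌋ + 1) ⌊t / T⌋ hmn
      have h4 := dist_triangle4 (σ s) ((ψ ^ (⌊s / T⌋ + 1)) x) ((ψ ^ ⌊t / T⌋) x) (σ t)
      rw [h1, h2, h3, hdecomp, hdecomp] at h4
      push_cast at h4
      linarith
  have hiso : ∀ s t, s ≤ t → dist (σ s) (σ t) = t - s := by
    intro s t hst
    refine le_antisymm (hlip s t hst) ?_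
    obtain ⟨N, hN⟩ := exists_nat_ge (max (-s) t / T)
    rw [div_le_iff₀ hT] at hN
    have hs : -s ≤ N * T := (le_max_left _ _).trans hN
    have ht : t ≤ N * T := (le_max_right _ _).trans hN
    have h1 : dist (σ ((-N : ℤ) * T)) (σ ((N : ℤ) * T)) = (N - (-N)) * T := by
      rw [hint, hint, hzpow _ _ (by omega)]
      push_cast; ring
    have h2 := dist_triangle4 (σ ((-N : ℤ) * T)) (σ s) (σ t) (σ ((N : ℤ) * T))
    have h3 := hlip ((-N : ℤ) * T) s (by push_cast; linarith)
    have h4 := hlip t ((N : ℤ) * T) (by push_cast; linarith)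
    push_cast at h1 h2 h3 h4
    linarith
  refine ⟨σ, Isometry.of_dist_eq fun s t => ?_, fun t => ?_⟩
  · rcases le_total s t with h | h
    · rw [hiso s t h, dist_comm, dist_eq, abs_of_nonneg (sub_nonneg.2 h)]
    · rw [dist_comm, hiso t s h, dist_eq, abs_of_nonneg (sub_nonneg.2 h)]
  · simp only [σ]
    rw [add_div, div_self hT.ne', Int.floor_add_one, Int.fract_add_one, add_comm ⌊t / T⌋,
      zpow_one_add, IsometryEquiv.mul_apply]

end HasStewartInequality

lemma IsometryEquiv.image_pow_eq {X : Type*} [MetricSpace X] {ψ : X ≃ᵢ X} {A : Set X}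
    (h : ψ '' A = A) (n : ℕ) : (ψ ^ n : X ≃ᵢ X) '' A = A := by
  induction n with
  | zero => simp
  | succ n ih =>
    have : ⇑(ψ ^ (n + 1)) = ⇑(ψ ^ n) ∘ ⇑ψ := by
      ext x; rw [pow_succ, IsometryEquiv.mul_apply, Function.comp_apply]
    rw [this, image_comp, h, ih]

lemma IsometryEquiv.infDist_apply_eq {X : Type*} [MetricSpace X] {ψ : X ≃ᵢ X} {A : Set X}
    (h : ψ '' A = A) (x : X) : Metric.infDist (ψ x) A = Metric.infDist x A := by
  conv_lhs => rw [← h]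
  exact Metric.infDist_image ψ.isometry

namespace HasStewartInequality

variable {X : Type*} [MetricSpace X]

/-- On an invariant line, the distance to an invariant set takes its value at a point again at
two points on either side, arbitrarily far away. -/
lemma exists_infDist_eq_far (hX : HasStewartInequality X) {ψ : X ≃ᵢ X} {T : ℝ} (hT : 0 < T)
    (h : ∀ x, T ≤ dist x (ψ x)) {A : Set X} (hA : ψ '' A = A) {β : ℝ → X} (hβ : Isometry β)
    (hB : ψ '' range β = range β) (D : ℝ) :
    ∃ d, D ≤ d ∧ Metric.infDist (β d) A = Metric.infDist (β 0) A ∧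
      Metric.infDist (β (-d)) A = Metric.infDist (β 0) A := by
  obtain ⟨k, hk⟩ := pow_unbounded_of_one_lt (D / T) (one_lt_two (α := ℝ))
  rw [div_lt_iff₀ hT] at hk
  set φ := ψ ^ 2 ^ k with hφ
  have hfar : ∀ x, 2 ^ k * T ≤ dist x (φ x) := hX.two_pow_mul_le_dist ψ hT.le h k
  have hφA : φ '' A = A := IsometryEquiv.image_pow_eq hA _
  have hφB : φ '' range β = range β := IsometryEquiv.image_pow_eq hB _
  obtain ⟨u, hu⟩ : φ (β 0) ∈ range β := hφB ▸ mem_image_of_mem _ (mem_range_self 0)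
  obtain ⟨_, ⟨v, rfl⟩, hv⟩ : β 0 ∈ φ '' range β := hφB.symm ▸ mem_range_self 0
  have hfu : Metric.infDist (β u) A = Metric.infDist (β 0) A := by
    rw [hu, IsometryEquiv.infDist_apply_eq hφA]
  have hfv : Metric.infDist (β v) A = Metric.infDist (β 0) A := by
    rw [← hv, IsometryEquiv.infDist_apply_eq hφA]
  have hdu : 2 ^ k * T ≤ |u| := by
    have := hfar (β 0)
    rwa [← hu, hβ.dist_eq, dist_comm, dist_zero_right, norm_eq_abs] at this
  have huv : |u| = |v| := by
    have := φ.dist_eq (β v) (β 0)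
    rwa [hv, ← hu, hβ.dist_eq, hβ.dist_eq, dist_zero_left, dist_zero_right] at this
  -- If `u = v`, then `φ` would swap `β 0` and `β u`, and its square would have a fixed point,
  -- contrary to the doubling of displacement. So `φ` does not reflect the line.
  have hne : u ≠ v := by
    rintro rfl
    have := hX.two_mul_le_dist_apply_apply φ (by positivity) hfar (β u)
    rw [hv, ← hu, dist_self] at this
    have : 0 < 2 ^ k * T := by positivity
    linarith
  have hvu : v = -u := by
    rcases abs_eq_abs.1 huv with h | h
    · exact absurd h hne
    · rw [h, neg_neg]
  refine ⟨|u|, hk.le.trans hdu, ?_⟩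
  rw [hvu] at hfv
  rcases abs_choice u with h | h
  · rw [h]; exact ⟨hfu, hfv⟩
  · rw [h, neg_neg]; exact ⟨hfv, hfu⟩

/-- The distance to `A` takes its value at `β 0` again at `β d` and `β (-d)` with `d` as large as
desired. Exponential decay from both ends then forces it to vanish at each fixed point of `B`. -/
lemma invariantLine_subset (hX : HasStewartInequality X) {ψ : X ≃ᵢ X} {T : ℝ} (hT : 0 < T)
    (h : ∀ x, T ≤ dist x (ψ x)) {A B : Set X} (hA : IsInvariantLine ψ A)
    (hB : IsInvariantLine ψ B) : B ⊆ A := by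
  obtain ⟨⟨σ, hσ, rfl⟩, hA⟩ := hA
  obtain ⟨⟨β, hβ, rfl⟩, hB⟩ := hB
  rintro _ ⟨t, rfl⟩
  set R := sinh (Metric.infDist (β 0) (range σ)) with hR
  have hR0 : 0 ≤ R := sinh_nonneg_iff.2 Metric.infDist_nonneg
  have key : ∀ D, |t| + 1 ≤ D →
      sinh (Metric.infDist (β t) (range σ)) ≤ R * (exp (-t) + exp t) * exp (-D) := by
    intro D hD
    obtain ⟨d, hDd, h1, h2⟩ := hX.exists_infDist_eq_far hT h hA hβ hB D
    have htd := abs_le.1 (show |t| ≤ d by linarith)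
    have hd0 : 0 < d := by linarith [abs_nonneg t]
    have := hX.sinh_infDist_le_exp hσ (γ := fun s => β (s - d)) (L := 2 * d) (t := t + d) (R := R)
      (by linarith) (fun s _ t _ => by rw [hβ.dist_eq, dist_sub_right, dist_eq])
      ⟨by linarith, by linarith⟩ (by rw [zero_sub, h2])
      (by rw [show 2 * d - d = d by ring, h1])
    rw [add_sub_cancel_right] at this
    refine this.trans ?_
    rw [mul_assoc]
    refine mul_le_mul_of_nonneg_left ?_ hR0
    rw [add_mul, ← exp_add, ← exp_add]
    gcongr
    · linarith
    · linarith
  have hlim : Tendsto (fun D : ℝ => R * (exp (-t) + exp t) * exp (-D)) atTop (𝓝 0) := by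
    simpa using (tendsto_exp_neg_atTop_nhds_zero).const_mul (R * (exp (-t) + exp t))
  have hle : sinh (Metric.infDist (β t) (range σ)) ≤ 0 :=
    ge_of_tendsto hlim (eventually_atTop.2 ⟨_, key⟩)
  rw [sinh_nonpos_iff] at hle
  obtain ⟨u, hu⟩ := hσ.exists_infDist_range_eq (β t)
  rw [hu] at hle
  exact ⟨u, (dist_le_zero.1 hle).symm⟩

lemma isAxis_range (hX : HasStewartInequality X) {ψ : X ≃ᵢ X} (hψ : IsHyperbolicIsometry ψ)
    {σ : ℝ → X} (hσ : Isometry σ) (h : ∀ t, ψ (σ t) = σ (t + translationLength ψ)) :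
    IsAxis ψ (range σ) := by
  have hA : IsInvariantLine ψ (range σ) := by
    refine ⟨⟨σ, hσ, rfl⟩, subset_antisymm ?_ ?_⟩
    · rintro _ ⟨_, ⟨t, rfl⟩, rfl⟩
      exact ⟨_, (h t).symm⟩
    · rintro _ ⟨t, rfl⟩
      exact ⟨_, ⟨t - translationLength ψ, rfl⟩, by rw [h, sub_add_cancel]⟩
  exact ⟨hA, fun B hB => subset_antisymm
    (hX.invariantLine_subset hψ.2 (translationLength_le ψ) hA hB)
    (hX.invariantLine_subset hψ.2 (translationLength_le ψ) hB hA)⟩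

/-! ### The closing property -/

/-- By the addition formula and `cosh g ≤ 1 + sinh g`. The bound is affine in `K`, as the
contraction argument requires. -/
lemma sinh_le_of_le_add {x g ε K : ℝ} (hg : 0 ≤ g) (hε : 0 ≤ ε) (hx : x ≤ g + ε)
    (hK : sinh g ≤ K) : sinh x ≤ K * exp ε + sinh ε := by
  have h1 : sinh x ≤ sinh (g + ε) := sinh_le_sinh.2 hx
  rw [sinh_add] at h1
  have hsg : 0 ≤ sinh g := sinh_nonneg_iff.2 hg
  have hsε : 0 ≤ sinh ε := sinh_nonneg_iff.2 hε
  have h2 : cosh g ≤ 1 + K := by nlinarith [cosh_sq g, cosh_pos g]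
  have h3 := mul_le_mul_of_nonneg_right hK (cosh_pos ε).le
  have h4 := mul_le_mul_of_nonneg_right h2 hsε
  rw [← cosh_add_sinh]
  linarith

/-- The contraction factor is at most `exp (-(2 * ε))`: the term with `s` contributes at most `exp
(-(3 * ε))`, and the condition on `l` covers the difference. The fixed point of `R ↦ R * exp (-(2 *
ε)) + sinh ε` is exactly `exp ε / 2`. -/
lemma le_exp_div_two {R ε s l : ℝ} (hR : 0 ≤ R) (hε : 0 < ε) (hs : 4 * ε ≤ s)
    (hl : exp (ε - l) ≤ exp (-(2 * ε)) - exp (-(3 * ε)))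
    (h : R ≤ R * (exp (-s) + exp (-l)) * exp ε + sinh ε) : R ≤ exp ε / 2 := by
  have h1 : (exp (-s) + exp (-l)) * exp ε ≤ exp (-(2 * ε)) := by
    rw [add_mul, ← exp_add, ← exp_add, neg_add_eq_sub, neg_add_eq_sub]
    have : exp (ε - s) ≤ exp (-(3 * ε)) := exp_le_exp.2 (by linarith)
    linarith
  have h2 : R ≤ R * exp (-(2 * ε)) + sinh ε := by
    rw [mul_assoc] at h
    linarith [mul_le_mul_of_nonneg_left h1 hR]
  have h3 : exp (-(2 * ε)) < 1 := by rw [exp_lt_one_iff]; linarith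
  have h4 : sinh ε = exp ε / 2 * (1 - exp (-(2 * ε))) := by
    have : exp ε * exp (-(2 * ε)) = exp (-ε) := by rw [← exp_add]; ring_nf
    rw [sinh_eq]; linear_combination this / 2
  refine le_of_mul_le_mul_right ?_ (sub_pos.2 h3)
  rw [← h4]
  linarith

theorem hasClosingProperty (hX : HasStewartInequality X) (r : ℝ) {ε c₀ s₀ l₀ : ℝ} (hε : 0 < ε)
    (hc₀ : 0 < c₀) (hc : ε - log (ε / 8) ≤ c₀) (hs₀ : 4 * ε ≤ s₀) (hl₀ : 2 * c₀ ≤ l₀)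
    (hl₀' : exp (ε - l₀) ≤ exp (-(2 * ε)) - exp (-(3 * ε))) :
    HasClosingProperty X r ε c₀ s₀ l₀ := by
  intro l s hl hs γ ψ hγ hψ _ hclose
  obtain ⟨σ, hσ, hσψ⟩ := hX.exists_isometry_translated hψ
  have hl0 : 0 < l := by linarith
  have hs0 : 0 < s := by linarith
  have haxis := hX.isAxis_range hψ hσ hσψ
  have hA := haxis.1.2
  have hmove : ∀ t, dist (σ t) (ψ (σ t)) = translationLength ψ := fun t => by
    rw [hσψ, hσ.dist_eq, dist_self_add_right, norm_eq_abs, abs_of_pos hψ.2]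
  set f : ℝ → ℝ := fun t => Metric.infDist (γ t) (range σ) with hf
  have hf0 : ∀ t, 0 ≤ f t := fun t => Metric.infDist_nonneg
  set R := max (sinh (f 0)) (sinh (f (s + l))) with hR
  have hR0 : 0 ≤ R := (sinh_nonneg_iff.2 (hf0 0)).trans (le_max_left _ _)
  have hexp : ∀ t ∈ Icc 0 (s + l), sinh (f t) ≤ R * (exp (-t) + exp (-(s + l - t))) := fun t ht =>
    hX.sinh_infDist_le_exp hσ (by linarith) hγ ht (le_max_left _ _) (le_max_right _ _)
  have hfs : sinh (f s) ≤ R * (exp (-s) + exp (-l)) := by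
    have := hexp s ⟨hs0.le, by linarith⟩
    rwa [add_sub_cancel_left] at this
  have hfl : sinh (f l) ≤ R * (exp (-s) + exp (-l)) := by
    have := hexp l ⟨hl0.le, by linarith⟩
    rwa [add_sub_cancel_right, add_comm (exp (-l))] at this
  have h0 : f 0 ≤ f s + ε := by
    have h1 := hclose 0 ⟨le_rfl, hl0.le⟩
    rw [add_zero, dist_comm] at h1
    have h2 := Metric.infDist_le_infDist_add_dist (s := range σ) (x := ψ (γ 0)) (y := γ s)
    rw [IsometryEquiv.infDist_apply_eq hA] at h2
    exact h2.trans (by simpa [hf] using h1)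
  have hL : f (s + l) ≤ f l + ε := by
    have h1 := hclose l ⟨hl0.le, le_rfl⟩
    have h2 := Metric.infDist_le_infDist_add_dist (s := range σ) (x := γ (s + l)) (y := ψ (γ l))
    rw [IsometryEquiv.infDist_apply_eq hA] at h2
    exact h2.trans (by simpa [hf] using h1)
  have hRle : R ≤ exp ε / 2 := by
    refine le_exp_div_two hR0 hε (hs₀.trans hs.le)
      ((exp_le_exp.2 (sub_le_sub_left hl ε)).trans hl₀') (max_le ?_ ?_)
    · exact sinh_le_of_le_add (hf0 s) hε.le h0 hfs
    · exact sinh_le_of_le_add (hf0 l) hε.le hL hfl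
  -- The lower bound on `c₀` is this inequality after taking logarithms.
  have hexpc : exp (-c₀) * exp ε ≤ ε / 8 := by
    rw [← exp_add, ← exp_log (show 0 < ε / 8 by positivity), exp_le_exp]
    linarith
  have hsmall : ∀ t ∈ Icc c₀ (s + l - c₀), f t < ε / 8 := by
    intro t ht
    rw [← sinh_lt_sinh]
    calc sinh (f t) ≤ R * (exp (-t) + exp (-(s + l - t))) :=
          hexp t ⟨by linarith [ht.1], by linarith [ht.2]⟩
      _ ≤ exp ε / 2 * (exp (-c₀) + exp (-c₀)) := by
          gcongr
          · exact ht.1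
          · linarith [ht.2]
      _ = exp (-c₀) * exp ε := by ring
      _ ≤ ε / 8 := hexpc
      _ < sinh (ε / 8) := self_lt_sinh_iff.2 (by positivity)
  refine ⟨?_, ?_, range σ, haxis, ?_, ?_⟩
  -- At time `c₀` the geodesic is `ε / 8`-close to the axis, so `ψ` moves `γ c₀` by less than its
  -- translation length plus `ε / 4`. This gives a lower bound of `s - 5 * ε / 4`.
  · obtain ⟨u, hu⟩ := hσ.exists_infDist_range_eq (γ c₀)
    have h1 : dist (γ c₀) (σ u) < ε / 8 := hu ▸ hsmall c₀ ⟨le_rfl, by linarith⟩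
    have h2 := hclose c₀ ⟨hc₀.le, by linarith⟩
    have h3 := hγ c₀ ⟨hc₀.le, by linarith⟩ (s + c₀) ⟨by linarith, by linarith⟩
    rw [sub_add_cancel_right, abs_neg, abs_of_pos hs0] at h3
    have h4 := dist_triangle_right (γ c₀) (γ (s + c₀)) (ψ (γ c₀))
    have h5 := dist_triangle4 (γ c₀) (σ u) (ψ (σ u)) (ψ (γ c₀))
    rw [hmove, ψ.dist_eq, dist_comm (σ u)] at h5
    linarith
  · have h1 := hclose 0 ⟨le_rfl, hl0.le⟩
    rw [add_zero] at h1
    have h2 := hγ.dist_left (s := s) ⟨hs0.le, by linarith⟩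
    have h3 := dist_triangle (γ 0) (γ s) (ψ (γ 0))
    have h4 := translationLength_le ψ (γ 0)
    linarith
  · rintro _ ⟨t, rfl⟩
    exact hmove t
  · rintro _ ⟨t, ht, rfl⟩
    rw [Metric.mem_thickening_iff_infDist_lt (range_nonempty σ)]
    exact hsmall t ht

end HasStewartInequality

/-! ### Choice of the constants -/

lemma exists_closing_constants {ε δ : ℝ} (hε : 0 < ε) (hδ : 0 ≤ δ) :
    ∃ c₀ l₀ : ℝ, 0 < c₀ ∧ c₀ ≤ 2 * δ + ε - log (ε / 8) ∧ 4 * δ + ε ≤ l₀ ∧ 2 * c₀ ≤ l₀ ∧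
      ε - log (ε / 8) ≤ c₀ ∧ exp (ε - l₀) ≤ exp (-(2 * ε)) - exp (-(3 * ε)) := by
  set c₀ := 2 * δ + ε - log (ε / 8) with hc₀
  -- `K` is the value of `l₀` for which the last condition, the one feeding the contraction, is an
  -- equality.
  set K := ε - log (exp (-(2 * ε)) - exp (-(3 * ε))) with hK
  refine ⟨c₀, max (4 * δ + ε) (max (2 * c₀) K), ?_, le_rfl, le_max_left _ _,
    (le_max_left _ _).trans (le_max_right _ _), by linarith, ?_⟩
  -- `log (ε / 8) ≤ ε / 8 - 1` gives `c₀ > 0` for every `ε`, including `ε ≥ 8`, where the logarithm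
  -- is nonnegative.
  · have := log_le_sub_one_of_pos (show 0 < ε / 8 by positivity)
    linarith
  · have hpos : 0 < exp (-(2 * ε)) - exp (-(3 * ε)) :=
      sub_pos.2 (exp_lt_exp.2 (by linarith))
    calc exp (ε - max (4 * δ + ε) (max (2 * c₀) K)) ≤ exp (ε - K) :=
          exp_le_exp.2 (sub_le_sub_left ((le_max_right _ _).trans (le_max_right _ _)) _)
      _ = exp (-(2 * ε)) - exp (-(3 * ε)) := by rw [hK, sub_sub_cancel, exp_log hpos]

theorem mainTheorem6 (ε₀ : ℝ) (hε₀ : 0 < ε₀) :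
    -- real hyperbolic spaces and all proper `CAT(-1)` spaces, with `δ₀ = log (1 + √2)`
    (∃ c₀ l₀ : ℝ, 0 < c₀ ∧
      c₀ ≤ 2 * Real.log (1 + √2) + ε₀ - Real.log (ε₀ / 8) ∧
      4 * Real.log (1 + √2) + ε₀ ≤ l₀ ∧
      2 * c₀ ≤ (4 * ε₀ + 6 * Real.log (1 + √2)) + l₀ ∧
      (∀ n : ℕ, HasClosingProperty (HyperbolicSpace (n + 1))
        (4 * Real.log (1 + √2)) ε₀ c₀ (4 * ε₀ + 6 * Real.log (1 + √2)) l₀) ∧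
      (∀ (Z : Type u) [MetricSpace Z] [ProperSpace Z], IsCATNegOne Z →
        HasClosingProperty Z
          (4 * Real.log (1 + √2)) ε₀ c₀ (4 * ε₀ + 6 * Real.log (1 + √2)) l₀)) ∧
    -- proper `CAT(-1)` spaces that are `δ₀`-hyperbolic, for an arbitrary `δ₀`
    (∀ δ₀ : ℝ, 0 ≤ δ₀ →
      ∃ c₀ l₀ : ℝ, 0 < c₀ ∧
        c₀ ≤ 2 * δ₀ + ε₀ - Real.log (ε₀ / 8) ∧
        4 * δ₀ + ε₀ ≤ l₀ ∧
        2 * c₀ ≤ (4 * ε₀ + 6 * δ₀) + l₀ ∧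
        ∀ (Z : Type u) [MetricSpace Z] [ProperSpace Z], IsCATNegOne Z → IsDeltaHyperbolic Z δ₀ →
          HasClosingProperty Z (4 * δ₀) ε₀ c₀ (4 * ε₀ + 6 * δ₀) l₀) := by
  have key : ∀ δ : ℝ, 0 ≤ δ → 4 * ε₀ ≤ 4 * ε₀ + 6 * δ := fun δ hδ => by linarith
  refine ⟨?_, fun δ₀ hδ => ?_⟩
  · have hδ : 0 ≤ log (1 + √2) := log_nonneg (by linarith [sqrt_nonneg 2])
    obtain ⟨c₀, l₀, hc₀, hc, hl, hcl, hc', hl'⟩ := exists_closing_constants hε₀ hδ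
    exact ⟨c₀, l₀, hc₀, hc, hl, by linarith,
      fun n => (HyperbolicSpace.hasStewartInequality (n + 1)).hasClosingProperty _ hε₀ hc₀ hc'
        (key _ hδ) hcl hl',
      fun Z _ _ hZ => hZ.hasStewartInequality.hasClosingProperty _ hε₀ hc₀ hc' (key _ hδ) hcl hl'⟩
  · obtain ⟨c₀, l₀, hc₀, hc, hl, hcl, hc', hl'⟩ := exists_closing_constants hε₀ hδ
    exact ⟨c₀, l₀, hc₀, hc, hl, by linarith,
      fun Z _ _ hZ _ =>
        hZ.hasStewartInequality.hasClosingProperty _ hε₀ hc₀ hc' (key _ hδ) hcl hl'⟩
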